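/- Let $U$ be an ultrafilter on a set $I$, and let ${}^{*}$ denote the nonstandard extension given by the ultrapower with respect to $U$ (standard objects being identified with constant classes; internal objects being classes of families of standard ones). For hyperreals, $r\approx s$ means $|r-s|<\varepsilon$ for every standard real $\varepsilon>0$; a hyperreal $r$ is infinitesimal if $r\approx 0$; for $x\in{}^{*}X$ and $a\in X$ in a metric space $(X,d)$, $x\approx a$ means ${}^{*}d(x,a)\approx 0$. Let $X$ be a compact metric space with its Borel $\sigma$-algebra $\mathcal B$, let $\{g(x,1,\cdot)\}_{x\in X}$ be a Markov transition kernel on $X$ with stationary probability distribution $\pi$, and let $(S_X,\{B(s)\}_{s\in S_X})$ be a hyperfinite representation of $X$: $S_X\subset{}^{*}X$ is hyperfinite, $\{B(s)\}_{s\in S_X}$ is an internal partition of ${}^{*}X$ into elements of ${}^{*}\mathcal B$ with $s\in B(s)$ for all $s\in S_X$, and for some positive infinitesimal $\delta$ every $B(s)$ has diameter at most $\delta$. For $i,j\in S_X$ put $$\Pi(\{i\})={}^{*}\pi(B(i)),\qquad G_i(\{j\})={}^{*}g(i,1,B(j)),$$ $$H_i(\{j\})=\frac{\int_{B(i)}{}^{*}g(x,1,B(j))\,{}^{*}\pi(dx)}{{}^{*}\pi(B(i))}\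 \text{ if } {}^{*}\pi(B(i))\neq 0,\qquad H_i(\{j\})=G_i(\{j\})\ \text{ otherwise.}$$ Let $\lambda$ be a Borel measure on $X$ which dominates $\pi$ and each $g(x,1,\cdot)$, $x\in X$, where "$\lambda$ dominates $P$" means that for every $\varepsilon>0$ there is $\delta>0$ such that $P(C)<\varepsilon$ for all $C\in\mathcal B$ with $\lambda(C)<\delta$. Let $k:X\to\mathbb R$ be a density function of $\pi$ with respect to $\lambda$ and, for each $x\in X$, let $f(x,\cdot):X\to\mathbb R$ be a density function of $g(x,1,\cdot)$ with respect to $\lambda$. Let $x_1,x_2\in X$, and suppose that $k$ is continuous at $x_1$ and that $f$ is jointly continuous at $(x_1,x_2)$. Then, for all $i,j\in S_X$ with $i\approx x_1$ and $j\approx x_2$: 1. if ${}^{*}\lambda(B(i))\neq 0$, then $\dfrac{\Pi(\{i\})}{{}^{*}\lambda(B(i))}\approx{}^{*}k(i)$; 2. if ${}^{*}\lambda(B(j))\neq 0$, then $\dfrac{G_i(\{j\})}{{}^{*}\lambda(B(j))}\approx{}^{*}f(i,j)\approx\dfrac{H_i(\{j\})}{{}^{*}\lambda(B(j))}$. (If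 $\lambda$ is infinite and a denominator ${}^{*}\lambda(B(\cdot))$ is infinite-valued, i.e. equal to $\infty\in{}^{*}[0,\infty]$, the quotient is read as $0$.) -/

import Mathlib

open MeasureTheory ProbabilityTheory
open scoped ENNReal

namespace NSMarkov

noncomputable section

/-- The nonstandard extension of `α`: the ultrapower of `α` by the ultrafilter `U`. A standard
`a : α` is identified with the constant germ `(a : Star U α)`. Applied to a type of sets,
functions, etc. it gives the *internal* sets, functions, etc. -/
abbrev Star {I : Type*} (U : Ultrafilter I) (α : Type*) : Type _ :=
  Filter.Germ (U : Filter I) α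

/-- The Borel `σ`-algebra of `X` as a collection of sets. `Star U (BorelSets X)` is the collection
of *Borel (internal) subsets of `Star U X`. -/
abbrev BorelSets (X : Type*) [MeasurableSpace X] : Type _ := {A : Set X // MeasurableSet A}

variable {I : Type*} {U : Ultrafilter I} {X : Type*}

/-- A hyperreal is infinitesimal if its absolute value is below every standard positive real
(zero is included). -/
def Infinitesimal (r : Star U ℝ) : Prop :=
  ∀ ε : ℝ, 0 < ε → |r| < (ε : Star U ℝ)

/-- `r ≈ s` for hyperreals. -/
def Near (r s : Star U ℝ) : Prop := Infinitesimal (r - s)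

/-- The extension of the metric of `X`. -/
def starDist [MetricSpace X] (x y : Star U X) : Star U ℝ := Filter.Germ.map₂ dist x y

/-- `x ≈ a`, for `x` in the extension of `X` and a standard point `a`. -/
def NearPoint [MetricSpace X] (x : Star U X) (a : X) : Prop :=
  Infinitesimal (starDist x (a : Star U X))

/-- Membership of a point of the extension of `X` in a *Borel set. -/
def InBorel [MeasurableSpace X] (x : Star U X) (A : Star U (BorelSets X)) : Prop :=
  Filter.Germ.LiftRel (fun x A => x ∈ A.1) x A

/-- Membership of a point of the extension of `X` in a hyperfinite set, that is, in an element of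
the extension of the collection of finite subsets of `X`. -/
def InHyperfinite (x : Star U X) (S : Star U (Finset X)) : Prop :=
  Filter.Germ.LiftRel (fun x S => x ∈ S) x S

/-- The extension of the diameter function. -/
def starDiam [MetricSpace X] [MeasurableSpace X] (A : Star U (BorelSets X)) : Star U ℝ :=
  Filter.Germ.map (fun A => Metric.diam A.1) A

/-- The value at `s` of an internal family of *Borel sets. -/
def cell [MeasurableSpace X] (B : Star U (X → BorelSets X)) (s : Star U X) :
    Star U (BorelSets X) :=
  Filter.Germ.map₂ (fun B s => B s) B s

/-- `(S, {B(s)}_{s ∈ S})` is a `δ`-hyperfinite representation of `X`. The internal family `B` is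
represented by an internal function on the whole extension of `X`; only its values on `S`
matter. -/
structure IsDeltaHyperfiniteRep [MetricSpace X] [MeasurableSpace X] (δ : Star U ℝ)
    (S : Star U (Finset X)) (B : Star U (X → BorelSets X)) : Prop where
  mem_cell : ∀ s : Star U X, InHyperfinite s S → InBorel s (cell B s)
  cover : ∀ x : Star U X, ∃ s : Star U X, InHyperfinite s S ∧ InBorel x (cell B s)
  diam_le : ∀ s : Star U X, InHyperfinite s S → starDiam (cell B s) ≤ δ
  disjoint : ∀ s₁ s₂ : Star U X, InHyperfinite s₁ S → InHyperfinite s₂ S → s₁ ≠ s₂ →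
    ∀ x : Star U X, ¬ (InBorel x (cell B s₁) ∧ InBorel x (cell B s₂))

/-- A hyperfinite representation of `X`: a `δ`-hyperfinite representation for some positive
infinitesimal `δ`. -/
def IsHyperfiniteRep [MetricSpace X] [MeasurableSpace X]
    (S : Star U (Finset X)) (B : Star U (X → BorelSets X)) : Prop :=
  ∃ δ : Star U ℝ, 0 < δ ∧ Infinitesimal δ ∧ IsDeltaHyperfiniteRep δ S B

/-- The extension of a measure, as a function on *Borel sets with values in the extension
of `[0, ∞]`. -/
def starMeasure [MeasurableSpace X] (μ : Measure X) (A : Star U (BorelSets X)) : Star U ℝ≥0∞ :=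
  Filter.Germ.map (fun A => μ A.1) A

/-- The extension of a kernel: `(x, A) ↦ g(x, 1, A)`. -/
def starKernel [MeasurableSpace X] (g : Kernel X X) (x : Star U X)
    (A : Star U (BorelSets X)) : Star U ℝ≥0∞ :=
  Filter.Germ.map₂ (fun x A => g x A.1) x A

/-- The internal integral `∫_A g(x, 1, C) π(dx)` for *Borel sets `A` and `C`. -/
def starKernelIntegral [MeasurableSpace X] (g : Kernel X X) (π : Measure X)
    (A C : Star U (BorelSets X)) : Star U ℝ≥0∞ :=
  Filter.Germ.map₂ (fun A C => ∫⁻ x in A.1, g x C.1 ∂π) A C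

/-- `Π({i}) = π(B(i))`. -/
def hyperPi [MeasurableSpace X] (π : Measure X) (B : Star U (X → BorelSets X))
    (i : Star U X) : Star U ℝ≥0∞ :=
  starMeasure π (cell B i)

/-- `G_i({j}) = g(i, 1, B(j))`. -/
def hyperG [MeasurableSpace X] (g : Kernel X X) (B : Star U (X → BorelSets X))
    (i j : Star U X) : Star U ℝ≥0∞ :=
  starKernel g i (cell B j)

open Classical in
/-- `H_i({j}) = (∫_{B(i)} g(x, 1, B(j)) π(dx)) / π(B(i))` if `π(B(i)) ≠ 0`, and
`H_i({j}) = G_i({j})` otherwise. -/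
def hyperH [MeasurableSpace X] (g : Kernel X X) (π : Measure X)
    (B : Star U (X → BorelSets X)) (i j : Star U X) : Star U ℝ≥0∞ :=
  if starMeasure π (cell B i) = 0 then hyperG g B i j
  else starKernelIntegral g π (cell B i) (cell B j) / starMeasure π (cell B i)

/-- The quotient `p / q` as a hyperreal. It is formed in the extension of `[0, ∞]`, and is
therefore finite there (no junk value) as soon as `p ≠ ∞` and `q ≠ 0`; the convention
`p / ∞ = 0` plays a role only if `q` is infinite. -/
def ratio (p q : Star U ℝ≥0∞) : Star U ℝ :=
  Filter.Germ.map ENNReal.toReal (p / q)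

/-- `Q` dominates `P`: for every `ε > 0` there is `δ > 0` such that `P(C) < ε` for all Borel sets
`C` with `Q(C) < δ`. -/
def Dominates [MeasurableSpace X] (Q P : Measure X) : Prop :=
  ∀ ε : ℝ≥0∞, 0 < ε → ∃ δ : ℝ≥0∞, 0 < δ ∧ ∀ C : Set X, MeasurableSet C → Q C < δ → P C < ε

/-- The real function `h` is a density function of the (finite) measure `P` with respect to `Q`:
`P(C) = ∫_C h dQ` for all Borel sets `C`. -/
def IsDensity [MeasurableSpace X] (P Q : Measure X) (h : X → ℝ) : Prop :=
  Integrable h Q ∧ ∀ C : Set X, MeasurableSet C → P.real C = ∫ x in C, h x ∂Q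

/-- The extension of a real function on `X`. -/
def starFun (k : X → ℝ) (x : Star U X) : Star U ℝ := Filter.Germ.map k x

/-- The extension of a real function of two variables on `X`. -/
def starFun₂ (f : X → X → ℝ) (x y : Star U X) : Star U ℝ := Filter.Germ.map₂ f x y

end

end NSMarkov

/-!
Everything reduces to a mean value estimate for one standard set. If `h` is a density of a finite
measure `P` with respect to `Q`, and `h` stays within `ε` of a constant `c` on a set `C` with
`Q C ≠ 0`, then `P C / Q C` is within `ε` of `c` (`IsDensity.abs_div_sub_le`). This remains true
for `Q C = ∞` with the convention `p / ∞ = 0`: as `h` is integrable, `∞` is a possible value of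
`Q C` only if `h` is not bounded away from zero on `C`, that is, only if `|c| ≤ ε`.

Along the ultrafilter, the cells of a hyperfinite representation near a standard point `a` are
eventually contained in every ball around `a` (`IsHyperfiniteRep.eventually_cell_subset_ball`), and
continuity bounds the oscillation of the density there. This gives the claims on `Π` and `G`, with
`c = k x₁` and `c = f x₁ x₂`.

For `H`, let `A` be the cell of `i` and `C` the cell of `j`. As a function of `A`, the integral
`∫_A g(x, C) / λ(C) π(dx)` is a finite measure whose density with respect to `π` is
`x ↦ g(x, C) / λ(C)`, and the estimate for `G` says that this density is close to `f x₁ x₂`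
on `A`. The mean value estimate applied a second time, now with `Q = π`, gives the claim
(`abs_kernel_average_div_sub_le`).
-/

namespace NSMarkov

/-! ### Mean value estimates for densities -/

section Standard

variable {X : Type*} [MeasurableSpace X]

/-- The mean value estimate. If `Q C = ∞` the quotient is `0`, and integrability of `h` forces
`|c| ≤ ε`. -/
theorem IsDensity.abs_div_sub_le {P Q : Measure X} [IsFiniteMeasure P] {h : X → ℝ}
    (hd : IsDensity P Q h) {C : Set X} (hC : MeasurableSet C) (hQ : Q C ≠ 0) {c ε : ℝ}
    (hc : ∀ y ∈ C, |h y - c| ≤ ε) : |(P C / Q C).toReal - c| ≤ ε := by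
  by_cases htop : Q C = ∞
  · rw [htop, ENNReal.div_top, ENNReal.toReal_zero, zero_sub, abs_neg]
    by_contra! hlt
    have hfin := hd.1.measure_norm_ge_lt_top (sub_pos.2 hlt)
    refine (lt_of_le_of_lt (measure_mono fun y hy => ?_) hfin).ne htop
    have h1 := abs_sub_abs_le_abs_sub c (h y)
    rw [abs_sub_comm] at h1
    simp only [Set.mem_ofPred_eq, Real.norm_eq_abs]
    linarith [hc y hy]
  · have hpos : 0 < Q.real C := ENNReal.toReal_pos hQ htop
    have hint : ∫ y in C, (h y - c) ∂Q = P.real C - c * Q.real C := by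
      rw [integral_sub hd.1.integrableOn (integrableOn_const htop), ← hd.2 C hC,
        setIntegral_const, smul_eq_mul, mul_comm]
    have hbound : |P.real C - c * Q.real C| ≤ ε * Q.real C := by
      rw [← hint]
      exact norm_setIntegral_le_of_norm_le_const (f := fun y => h y - c)
        (lt_top_iff_ne_top.2 htop) hc
    have heq : (P C / Q C).toReal - c = (P.real C - c * Q.real C) / Q.real C := by
      rw [ENNReal.toReal_div, sub_div, mul_div_assoc, div_self hpos.ne', mul_one]
      rfl
    rwa [heq, abs_div, abs_of_pos hpos, div_le_iff₀ hpos]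

/-- The mean value estimate for the average over `A` of the quotients `g x C / q`, obtained from
`IsDensity.abs_div_sub_le` for the measure with density `x ↦ g x C / q` with respect to `π`. -/
theorem abs_kernel_average_div_sub_le (g : Kernel X X) [IsMarkovKernel g] (π : Measure X)
    [IsProbabilityMeasure π] {A C : Set X} (hA : MeasurableSet A) (hC : MeasurableSet C)
    (hπ : π A ≠ 0) {q : ℝ≥0∞} (hq : q ≠ 0) {c ε : ℝ}
    (hc : ∀ x ∈ A, |(g x C / q).toReal - c| ≤ ε) :
    |((∫⁻ x in A, g x C ∂π) / π A / q).toReal - c| ≤ ε := by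
  have hm : Measurable fun x => g x C / q := (g.measurable_coe hC).div_const q
  have hle : ∀ x, g x C / q ≤ 1 / q := fun x => ENNReal.div_le_div_right prob_le_one q
  have hfin : ∫⁻ x, g x C / q ∂π ≠ ∞ := by
    refine ((lintegral_mono hle).trans_lt ?_).ne
    rw [lintegral_const, measure_univ, mul_one]
    exact ENNReal.div_lt_top ENNReal.one_ne_top hq
  have : IsFiniteMeasure (π.withDensity fun x => g x C / q) := isFiniteMeasure_withDensity hfin
  have hd : IsDensity (π.withDensity fun x => g x C / q) π fun x => (g x C / q).toReal := by
    refine ⟨integrable_toReal_of_lintegral_ne_top hm.aemeasurable hfin, fun D hD => ?_⟩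
    rw [measureReal_def, withDensity_apply _ hD, integral_toReal hm.aemeasurable]
    exact Filter.Eventually.of_forall fun x =>
      (hle x).trans_lt (ENNReal.div_lt_top ENNReal.one_ne_top hq)
  have hmain := hd.abs_div_sub_le hA hπ hc
  have heq : (∫⁻ x in A, g x C ∂π) / π A / q = (∫⁻ x in A, g x C / q ∂π) / π A := by
    simp only [div_eq_mul_inv]
    rw [lintegral_mul_const _ (g.measurable_coe hC), mul_right_comm]
  rwa [withDensity_apply _ hA, ← heq] at hmain

end Standard

/-! ### Transfer to the ultrapower -/

section Transfer

variable {I : Type*} {U : Ultrafilter I} {X : Type*}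

theorem infinitesimal_coe {u : I → ℝ} :
    Infinitesimal (U := U) (u : Star U ℝ) ↔ ∀ ε : ℝ, 0 < ε → ∀ᶠ n in U, |u n| < ε := by
  refine forall₂_congr fun ε _ => ?_
  rw [Filter.Germ.abs_def]
  exact Filter.Germ.coe_lt

theorem near_coe {u v : I → ℝ} :
    Near (U := U) (u : Star U ℝ) (v : Star U ℝ) ↔
      ∀ ε : ℝ, 0 < ε → ∀ᶠ n in U, |u n - v n| < ε :=
  infinitesimal_coe (u := fun n => u n - v n)

/-- Two hyperreals are near each other as soon as both are near the same standard real `c`. -/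
theorem near_coe_of_eventually_le {u v : I → ℝ} (c : ℝ)
    (hu : ∀ ε : ℝ, 0 < ε → ∀ᶠ n in U, |u n - c| ≤ ε)
    (hv : ∀ ε : ℝ, 0 < ε → ∀ᶠ n in U, |v n - c| ≤ ε) :
    Near (U := U) (u : Star U ℝ) (v : Star U ℝ) := by
  refine near_coe.2 fun ε hε => ?_
  filter_upwards [hu (ε / 3) (by positivity), hv (ε / 3) (by positivity)] with n h1 h2
  have h3 := abs_sub_le (u n) c (v n)
  rw [abs_sub_comm c] at h3
  linarith

theorem germ_ne_zero_iff {p : I → ℝ≥0∞} :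
    (p : Star U ℝ≥0∞) ≠ 0 ↔ ∀ᶠ n in U, p n ≠ 0 := by
  rw [Ultrafilter.eventually_not]
  exact not_congr Filter.Germ.coe_eq

theorem NearPoint.tendsto [MetricSpace X] {x : I → X} {a : X}
    (h : NearPoint (U := U) (x : Star U X) a) : Filter.Tendsto x U (nhds a) := by
  refine Metric.tendsto_nhds.2 fun ε hε => ?_
  filter_upwards [infinitesimal_coe (u := fun n => dist (x n) a) |>.1 h ε hε] with n hn
  rwa [abs_of_nonneg dist_nonneg] at hn

/-- A cell of a hyperfinite representation whose index is near the standard point `a` lies in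
every standard ball around `a`. Compactness excludes
unbounded cells, to which `Metric.diam` assigns the value `0`. -/
theorem IsHyperfiniteRep.eventually_cell_subset_ball [MetricSpace X] [CompactSpace X]
    [MeasurableSpace X] {S : Star U (Finset X)} {B : I → X → BorelSets X}
    (hS : IsHyperfiniteRep S (B : Star U (X → BorelSets X))) {s : I → X}
    (hs : InHyperfinite (s : Star U X) S) {a : X} (ha : NearPoint (U := U) (s : Star U X) a)
    {r : ℝ} (hr : 0 < r) : ∀ᶠ n in U, (B n (s n)).1 ⊆ Metric.ball a r := by
  obtain ⟨δ, -, hδ, hrep⟩ := hS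
  induction δ using Filter.Germ.inductionOn with | _ δ => ?_
  have hmem : ∀ᶠ n in U, s n ∈ (B n (s n)).1 := hrep.mem_cell _ hs
  have hdiam : ∀ᶠ n in U, Metric.diam (B n (s n)).1 ≤ δ n := hrep.diam_le _ hs
  filter_upwards [hmem, hdiam, infinitesimal_coe.1 hδ (r / 2) (by positivity),
    Metric.tendsto_nhds.1 ha.tendsto (r / 2) (by positivity)] with n h1 h2 h3 h4 y hy
  have h5 := Metric.dist_le_diam_of_mem (Metric.isBounded_of_compactSpace) hy h1
  have h6 := dist_triangle y (s n) a
  rw [Metric.mem_ball]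
  linarith [le_abs_self (δ n)]

end Transfer

end NSMarkov

theorem mainTheorem3 {I : Type*} (U : Ultrafilter I)
    {X : Type*} [MetricSpace X] [CompactSpace X] [MeasurableSpace X] [BorelSpace X]
    (g : Kernel X X) [IsMarkovKernel g]
    (π : Measure X) [IsProbabilityMeasure π] (hπ : Kernel.Invariant g π)
    (S : NSMarkov.Star U (Finset X)) (B : NSMarkov.Star U (X → NSMarkov.BorelSets X))
    (hS : NSMarkov.IsHyperfiniteRep S B)
    (lam : Measure X)
    (hπdom : NSMarkov.Dominates lam π) (hgdom : ∀ x : X, NSMarkov.Dominates lam (g x))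
    (k : X → ℝ) (hk : NSMarkov.IsDensity π lam k)
    (f : X → X → ℝ) (hf : ∀ x : X, NSMarkov.IsDensity (g x) lam (f x))
    (x₁ x₂ : X) (hkc : ContinuousAt k x₁)
    (hfc : ContinuousAt (fun p : X × X => f p.1 p.2) (x₁, x₂))
    (i j : NSMarkov.Star U X)
    (hi : NSMarkov.InHyperfinite i S) (hj : NSMarkov.InHyperfinite j S)
    (hix : NSMarkov.NearPoint i x₁) (hjx : NSMarkov.NearPoint j x₂) :
    (NSMarkov.starMeasure lam (NSMarkov.cell B i) ≠ 0 →
      NSMarkov.Near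
        (NSMarkov.ratio (NSMarkov.hyperPi π B i) (NSMarkov.starMeasure lam (NSMarkov.cell B i)))
        (NSMarkov.starFun k i)) ∧
    (NSMarkov.starMeasure lam (NSMarkov.cell B j) ≠ 0 →
      NSMarkov.Near
        (NSMarkov.ratio (NSMarkov.hyperG g B i j)
          (NSMarkov.starMeasure lam (NSMarkov.cell B j)))
        (NSMarkov.starFun₂ f i j) ∧
      NSMarkov.Near
        (NSMarkov.starFun₂ f i j)
        (NSMarkov.ratio (NSMarkov.hyperH g π B i j)
          (NSMarkov.starMeasure lam (NSMarkov.cell B j)))) := by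
  induction i using Filter.Germ.inductionOn with | _ i => ?_
  induction j using Filter.Germ.inductionOn with | _ j => ?_
  induction B using Filter.Germ.inductionOn with | _ B => ?_
  have hki : ∀ ε : ℝ, 0 < ε → ∀ᶠ n in U, |k (i n) - k x₁| ≤ ε := fun ε hε =>
    (Metric.tendsto_nhds.1 (hkc.tendsto.comp hix.tendsto) ε hε).mono fun n hn => le_of_lt hn
  have hfij : ∀ ε : ℝ, 0 < ε → ∀ᶠ n in U, |f (i n) (j n) - f x₁ x₂| ≤ ε := fun ε hε =>
    (Metric.tendsto_nhds.1 (hfc.tendsto.comp (hix.tendsto.prodMk_nhds hjx.tendsto)) ε hε).mono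
      fun n hn => le_of_lt hn
  refine ⟨fun h0 => ?_, fun h0 => ?_⟩
  · refine NSMarkov.near_coe_of_eventually_le (u := fun n =>
      (π (B n (i n)).1 / lam (B n (i n)).1).toReal) (k x₁) (fun ε hε => ?_) hki
    obtain ⟨r, hr, hball⟩ := Metric.continuousAt_iff.1 hkc ε hε
    filter_upwards [NSMarkov.germ_ne_zero_iff.1 h0,
      hS.eventually_cell_subset_ball hi hix hr] with n hn hsub
    exact hk.abs_div_sub_le (B n (i n)).2 hn fun y hy => (hball (hsub hy)).le
  -- The estimate for `G` is uniform over a ball around `x₁`, as its average over a cell requires.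
  have huniform : ∀ ε : ℝ, 0 < ε → ∃ r : ℝ, 0 < r ∧ ∀ᶠ n in U, lam (B n (j n)).1 ≠ 0 ∧
      ∀ x ∈ Metric.ball x₁ r,
        |(g x (B n (j n)).1 / lam (B n (j n)).1).toReal - f x₁ x₂| ≤ ε := by
    intro ε hε
    obtain ⟨r, hr, hball⟩ := Metric.continuousAt_iff.1 hfc ε hε
    refine ⟨r, hr, ?_⟩
    filter_upwards [NSMarkov.germ_ne_zero_iff.1 h0,
      hS.eventually_cell_subset_ball hj hjx hr] with n hn hsub
    exact ⟨hn, fun x hx => (hf x).abs_div_sub_le (B n (j n)).2 hn fun y hy =>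
      (hball (x := (x, y)) (max_lt hx (hsub hy))).le⟩
  have hG : ∀ ε : ℝ, 0 < ε → ∀ᶠ n in U,
      |(g (i n) (B n (j n)).1 / lam (B n (j n)).1).toReal - f x₁ x₂| ≤ ε := by
    intro ε hε
    obtain ⟨r, hr, hev⟩ := huniform ε hε
    filter_upwards [hev, Metric.tendsto_nhds.1 hix.tendsto r hr] with n hn hir
    exact hn.2 _ hir
  refine ⟨NSMarkov.near_coe_of_eventually_le _ hG hfij, ?_⟩
  rw [NSMarkov.hyperH]
  split_ifs with hπ0
  · exact NSMarkov.near_coe_of_eventually_le _ hfij hG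
  · refine NSMarkov.near_coe_of_eventually_le (v := fun n =>
      ((∫⁻ x in (B n (i n)).1, g x (B n (j n)).1 ∂π) / π (B n (i n)).1 /
        lam (B n (j n)).1).toReal) _ hfij fun ε hε => ?_
    obtain ⟨r, hr, hev⟩ := huniform ε hε
    filter_upwards [hev, NSMarkov.germ_ne_zero_iff.1 hπ0,
      hS.eventually_cell_subset_ball hi hix hr] with n hn hπn hsub
    exact NSMarkov.abs_kernel_average_div_sub_le g π (B n (i n)).2 (B n (j n)).2 hπn hn.1
      fun x hx => hn.2 x (hsub hx)
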